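/- Let $G=(V,E)$ be a finite simple undirected graph with $n=|V|$. For $A\subseteq V$ let $G_A$ denote the subgraph induced on $A$, and let $N_G[A]$ denote the set $A$ together with all neighbours of vertices of $A$; write $N_G[v]=N_G[\{v\}]$. For vertices $u,v$, a set $S\subseteq V\setminus\{u,v\}$ is a $uv$-separator of $G$ if every path from $u$ to $v$ meets $S$; it is a minimal $uv$-separator if no proper subset of $S$ is a $uv$-separator. A clique minimal separator of $G$ is a complete set that is a minimal $uv$-separator for some $u,v\in V$. An atom of $G$ is (the vertex set $A$ of) an induced subgraph $G_A$ that is connected, has no clique minimal separator (of $G_A$), and is maximal under inclusion with these two properties. A set $A\subseteq V$ is convex in $G$ if no path of $G$ joining two distinct non-adjacent vertices of $A$ has all its internal vertices in $V\setminus A$; the convex hull of $R\subseteq V$ in $G$ is the least convex set containing $R$. A bijection $\alpha:V\to\{1,\dots,n\}$ is an MCS ordering of $G$ if it can be produced by Maximum Cardinality Search, with ties broken arbitrarily: start with weight $w(v)=0$ for all $v$; for $i=n,n-1,\dots,1$, choose an unnumbered vertex $v$ of maximum weight, set $\alpha(v)=i$, and increase by $1$ the weight of every unnumbered neighbour of $v$.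 The Recursive Decomposition Algorithm (RDA), on input $G$ and an MCS ordering $\alpha$ of $G$, starts with $W=V$ and $\mathcal U=\emptyset$. As long as $W\neq\emptyset$, it lets $v$ be the vertex of $W$ with smallest $\alpha(v)$, lets $H$ be the convex hull of $N_{G_W}[v]$ in $G_W$, adds $H$ to $\mathcal U$ if $H$ is contained in no member of $\mathcal U$, and replaces $W$ by $N_{G_W}[W\setminus H]$. When $W=\emptyset$ it returns $\mathcal U$. Theorem. For every finite simple undirected graph $G$ and every MCS ordering $\alpha$ of $G$, the RDA terminates and the set $\mathcal U$ it returns is exactly the set of all atoms of $G$. -/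

import Mathlib

namespace RDA

variable {V : Type*}

/-- `S` separates `u` from `v` in `G`: the two vertices lie outside `S` and every path from
`u` to `v` passes through `S`. -/
def IsSeparator (G : SimpleGraph V) (u v : V) (S : Set V) : Prop :=
  u ∉ S ∧ v ∉ S ∧ ∀ p : G.Walk u v, p.IsPath → ∃ x ∈ p.support, x ∈ S

/-- `S` is a minimal `uv`-separator of `G`: no proper subset of `S` separates `u` from `v`. -/
def IsMinimalUVSeparator (G : SimpleGraph V) (u v : V) (S : Set V) : Prop :=
  IsSeparator G u v S ∧ ∀ S' : Set V, S' ⊂ S → ¬ IsSeparator G u v S'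

/-- `S` is a clique minimal separator of `G`: it is complete, and it is a minimal
`uv`-separator for some pair of vertices `u`, `v`. -/
def IsCliqueMinimalSeparator (G : SimpleGraph V) (S : Set V) : Prop :=
  (∃ u v : V, IsMinimalUVSeparator G u v S) ∧ G.IsClique S

/-- The induced subgraph `G_A` is connected and has no clique minimal separator. -/
def IsPrimeSet (G : SimpleGraph V) (A : Set V) : Prop :=
  (G.induce A).Connected ∧ ¬ ∃ S : Set A, IsCliqueMinimalSeparator (G.induce A) S

/-- `A` is the vertex set of an atom of `G`: the induced subgraph `G_A` is connected, has no
clique minimal separator, and is maximal with these properties. -/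
def IsGraphAtom (G : SimpleGraph V) (A : Set V) : Prop :=
  Maximal (IsPrimeSet G) A

/-- `G_A` is convex in `G`: no path of `G` joining two distinct non-adjacent vertices of `A`
has all its internal vertices outside `A`. -/
def IsConvexSet (G : SimpleGraph V) (A : Set V) : Prop :=
  ∀ u ∈ A, ∀ v ∈ A, u ≠ v → ¬ G.Adj u v →
    ¬ ∃ p : G.Walk u v, p.IsPath ∧ ∀ x ∈ p.support, x ≠ u → x ≠ v → x ∉ A

/-- The convex hull of `R` in `G`. On a finite vertex set it is the least convex set
containing `R`, see `isLeast_hull`. -/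
def hull (G : SimpleGraph V) (R : Set V) : Set V :=
  ⋂₀ {A : Set V | R ⊆ A ∧ IsConvexSet G A}

theorem subset_hull (G : SimpleGraph V) (R : Set V) : R ⊆ hull G R :=
  fun _ hx _ hA => hA.1 hx

theorem exists_walk_to_convexSet (G : SimpleGraph V) {A : Set V} (hA : IsConvexSet G A)
    {w v : V} (p : G.Walk w v) (hv : v ∈ A) :
    ∃ b ∈ A, (∃ p₁ : G.Walk w b, ∀ x ∈ p₁.support, x ∈ A → x = b) ∧
      ∃ q : G.Walk b v, ∀ x ∈ q.support, x ∈ A ∧ x ∈ p.support := by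
  classical
  induction p with
  | nil => exact ⟨_, hv, ⟨.nil, by simp⟩, .nil, by simpa using hv⟩
  | @cons w w' v h p ih =>
    obtain ⟨b, hb, ⟨p₁, hp₁⟩, q, hq⟩ := ih hv
    by_cases hw : w ∈ A
    · refine ⟨w, hw, ⟨.nil, by simp⟩, ?_⟩
      by_cases hwb : w = b
      · subst hwb
        exact ⟨q, fun x hx => ⟨(hq x hx).1, by simp [(hq x hx).2]⟩⟩
      by_cases hadj : G.Adj w b
      · refine ⟨.cons hadj q, fun x hx => ?_⟩
        rcases List.mem_cons.1 (by simpa using hx) with rfl | hx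
        · exact ⟨hw, by simp⟩
        · exact ⟨(hq x hx).1, by simp [(hq x hx).2]⟩
      · refine absurd ⟨(SimpleGraph.Walk.cons h p₁).bypass,
          SimpleGraph.Walk.bypass_isPath _, fun x hx hxw hxb hxA => ?_⟩ (hA w hw b hb hwb hadj)
        rcases List.mem_cons.1 (by simpa using SimpleGraph.Walk.support_bypass_subset_support _ hx)
          with rfl | hx
        · exact hxw rfl
        · exact hxb (hp₁ x hx hxA)
    · refine ⟨b, hb, ⟨.cons h p₁, fun x hx hxA => ?_⟩, q,
        fun x hx => ⟨(hq x hx).1, by simp [(hq x hx).2]⟩⟩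
      rcases List.mem_cons.1 (by simpa using hx) with rfl | hx
      · exact absurd hxA hw
      · exact hp₁ x hx hxA

theorem exists_walk_in_convexSet (G : SimpleGraph V) {A : Set V} (hA : IsConvexSet G A)
    {u v : V} (p : G.Walk u v) (hu : u ∈ A) (hv : v ∈ A) :
    ∃ q : G.Walk u v, ∀ x ∈ q.support, x ∈ A ∧ x ∈ p.support := by
  obtain ⟨b, -, ⟨p₁, hp₁⟩, q, hq⟩ := exists_walk_to_convexSet G hA p hv
  obtain rfl : u = b := hp₁ u (by simp) hu
  exact ⟨q, hq⟩

theorem isConvexSet_sInter [Finite V] (G : SimpleGraph V) (F : Set (Set V))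
    (hF : ∀ A ∈ F, IsConvexSet G A) : IsConvexSet G (⋂₀ F) := by
  rintro u hu v hv huv hadj ⟨p, -, hp⟩
  have key : ∀ F' : Set (Set V), F' ⊆ F →
      ∃ q : G.Walk u v, ∀ x ∈ q.support, x ∈ ⋂₀ F' ∧ x ∈ p.support := by
    intro F'
    induction F', F'.toFinite using Set.Finite.induction_on with
    | empty => exact fun _ => ⟨p, by simp⟩
    | @insert A F' _ _ ih =>
      intro hsub
      obtain ⟨q, hq⟩ := ih (fun B hB => hsub (Set.mem_insert_of_mem _ hB))
      have hAF : A ∈ F := hsub (Set.mem_insert _ _)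
      obtain ⟨r, hr⟩ := exists_walk_in_convexSet G (hF A hAF) q (hu A hAF) (hv A hAF)
      refine ⟨r, fun x hx => ?_⟩
      rw [Set.sInter_insert]
      exact ⟨⟨(hr x hx).1, (hq x (hr x hx).2).1⟩, (hq x (hr x hx).2).2⟩
  obtain ⟨q, hq⟩ := key F subset_rfl
  cases q with
  | nil => exact huv rfl
  | @cons _ w _ h q =>
    have hw := hq w (by simp)
    have hwu : w ≠ u := h.ne'
    by_cases hwv : w = v
    · exact hadj (hwv ▸ h)
    · exact hp w hw.2 hwu hwv hw.1

theorem isLeast_hull [Finite V] (G : SimpleGraph V) (R : Set V) :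
    IsLeast {A : Set V | R ⊆ A ∧ IsConvexSet G A} (hull G R) :=
  ⟨⟨subset_hull G R, isConvexSet_sInter G _ fun _ hA => hA.2⟩, fun _ hA => Set.sInter_subset_of_mem hA⟩

/-- `N_G[A]`, the closed neighbourhood of a set `A` of vertices of `G`. -/
def closedNbhd (G : SimpleGraph V) (A : Set V) : Set V :=
  {x | x ∈ A ∨ ∃ w ∈ A, G.Adj w x}

open Classical in
/-- The states that Maximum Cardinality Search can reach on `G`. In `MCSRun G L w`, the list
`L = [v_{i+1}, …, v_n]` holds the vertices numbered so far, in increasing order of their labels,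
and `w` gives the current weights. Each step chooses an unnumbered vertex `v` of
maximum weight, gives it the next smaller label, and adds one to the weight of each
unnumbered neighbour of `v`. Ties are broken arbitrarily. -/
inductive MCSRun (G : SimpleGraph V) : List V → (V → ℕ) → Prop
  | init : MCSRun G [] (fun _ => 0)
  | step {L : List V} {w : V → ℕ} (h : MCSRun G L w) (v : V) (hv : v ∉ L)
      (hmax : ∀ u, u ∉ L → w u ≤ w v) :
      MCSRun G (v :: L) (fun u => if G.Adj v u ∧ u ∉ v :: L then w u + 1 else w u)

/-- A node ordering `α` of `G` (with labels `0, …, n - 1` in place of `1, …, n`) is an MCS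
ordering if the list of all vertices by increasing label is produced by a run of Maximum
Cardinality Search. -/
def IsMCSOrdering [Fintype V] (G : SimpleGraph V) (α : V ≃ Fin (Fintype.card V)) : Prop :=
  ∃ w : V → ℕ, MCSRun G (List.ofFn α.symm) w

/-- The vertex of `W` with the smallest label. -/
noncomputable def minVertex [Fintype V] (α : V ≃ Fin (Fintype.card V)) (W : Set V)
    (hW : W.Nonempty) : V :=
  Function.argminOn α W hW

theorem minVertex_mem [Fintype V] (α : V ≃ Fin (Fintype.card V)) (W : Set V)
    (hW : W.Nonempty) : minVertex α W hW ∈ W :=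
  Function.argminOn_mem α W hW

/-- The set `H` computed in one pass of the loop: the convex hull, in the current graph `G_W`,
of the closed neighbourhood in `G_W` of the vertex `v` of `W`, as a set of vertices of `G`. -/
def hullStep (G : SimpleGraph V) (W : Set V) (v : W) : Set V :=
  Subtype.val '' hull (G.induce W) (closedNbhd (G.induce W) {v})

/-- The next vertex set `N_{G_W}[W \ H]`, as a set of vertices of `G`. -/
def nextVertices (G : SimpleGraph V) (W H : Set V) : Set V :=
  Subtype.val '' closedNbhd (G.induce W) {x : W | (x : V) ∉ H}

theorem nextVertices_ssubset (G : SimpleGraph V) (W : Set V) (v : W) :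
    nextVertices G W (hullStep G W v) ⊂ W := by
  refine (Set.ssubset_iff_of_subset ?_).2 ⟨v, v.2, ?_⟩
  · rintro _ ⟨x, -, rfl⟩
    exact x.2
  · rintro ⟨x, hx, hxv⟩
    obtain rfl : x = v := Subtype.ext hxv
    rcases hx with hx | ⟨y, hy, hyx⟩
    · exact hx ⟨x, subset_hull _ _ (Or.inl rfl), rfl⟩
    · exact hy ⟨y, subset_hull _ _ (Or.inr ⟨x, rfl, hyx.symm⟩), rfl⟩

open Classical in
/-- The loop of the Recursive Decomposition Algorithm, started with current vertex set `W`
(so that the current graph is `G_W`) and with the sets `U` found so far. -/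
noncomputable def rdaLoop [Fintype V] (G : SimpleGraph V) (α : V ≃ Fin (Fintype.card V))
    (W : Set V) (U : Set (Set V)) : Set (Set V) :=
  if hW : W.Nonempty then
    let v : W := ⟨minVertex α W hW, minVertex_mem α W hW⟩
    let H : Set V := hullStep G W v
    rdaLoop G α (nextVertices G W H) (if ∀ A ∈ U, ¬ H ⊆ A then insert H U else U)
  else U
termination_by W.ncard
decreasing_by exact Set.ncard_lt_ncard (nextVertices_ssubset G W _)

/-- The output `U_G` of the Recursive Decomposition Algorithm on `G` with the ordering `α`. -/
noncomputable def rda [Fintype V] (G : SimpleGraph V) (α : V ≃ Fin (Fintype.card V)) :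
    Set (Set V) :=
  rdaLoop G α Set.univ ∅

end RDA

/-!
The proof works with *splittings*: a vertex `z` of `B` splits `B` (`SplitsAt`) if some clique
through `z` separates two neighbours of `z` within `G[B]`.

* If the vertex `v` does not split `W`, then the convex hull `H` of its closed neighbourhood in
  `G_W` is connected and has no clique minimal separator (`isPrimeSet_hullStep`). Moreover, a set
  `H` that is convex in `G_W` attaches to each component of `W \ H` along a clique, so a prime
  subset of `W` lies in `H` or in `N[W \ H]`, the vertex set of the next pass
  (`IsPrimeSet.subset_or_subset_nextVertices`).
* In a Maximum Cardinality Search, no vertex `z` splits the set of `z` and the vertices numbered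
  before it, those with a larger label (`IsMCSOrdering.not_splitsAt`). For a clique `T` through `z` with sides `X` and `Y`,
  each numbered vertex of `T` adds to the weight of `z`, and so does any numbered neighbour of `z`
  on a side. Hence at every time before `z` is chosen, one of the sides contains no numbered
  neighbour of `z` and no unnumbered vertex heavier than the number of numbered vertices of `T`
  (`NoExcess`).
* The ordering restricted to a later vertex set `W` need not be one that the search produces on
  `G_W`, and a hull may fail to be prime. But a splitting at `z` after a pass with hull `H` yields
  one before the pass, unless `z` and all its remaining neighbours of larger label lie in `H`
  (`splitsAt_of_splitsAt_nextVertices`). So for the first vertex `v` of `W`, either `v` does not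
  split `W` and its hull is prime, or its neighbourhood in `W` lies in an earlier hull, whose trace
  on `W` is convex; the new hull is then contained in a member of `U` and is discarded
  (`LoopInvariant.isPrimeSet_or_subset`).

Thus all members of `U` are prime and every atom is eventually found. No member of `U` contains
another one: a hull inside an earlier member is not added, and a later hull does not contain an
earlier member, whose first vertex has been deleted. As each member lies in an atom, the members are
the atoms.
-/

namespace RDA

variable {V : Type*} {G : SimpleGraph V}

/-! ### Walks inside a vertex set -/

/-- `x` and `y` are joined by a walk of `G` all of whose vertices lie in `B`. Working with such
walks in the fixed graph `G` avoids passing to subtypes for each induced subgraph. -/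
def ReachIn (G : SimpleGraph V) (B : Set V) (x y : V) : Prop :=
  ∃ p : G.Walk x y, ∀ u ∈ p.support, u ∈ B

namespace ReachIn

variable {B B' : Set V} {x y z : V}

theorem refl (hx : x ∈ B) : ReachIn G B x x := ⟨.nil, by simpa using hx⟩

theorem symm : ReachIn G B x y → ReachIn G B y x := fun ⟨p, hp⟩ => ⟨p.reverse, by simpa using hp⟩

theorem trans : ReachIn G B x y → ReachIn G B y z → ReachIn G B x z := fun ⟨p, hp⟩ ⟨q, hq⟩ =>
  ⟨p.append q, fun u hu => (SimpleGraph.Walk.mem_support_append_iff _ _ |>.1 hu).elim (hp u) (hq u)⟩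

theorem mem_right : ReachIn G B x y → y ∈ B := fun ⟨p, hp⟩ => hp y p.end_mem_support

theorem mono (h : B ⊆ B') : ReachIn G B x y → ReachIn G B' x y :=
  fun ⟨p, hp⟩ => ⟨p, fun u hu => h (hp u hu)⟩

theorem of_adj (h : G.Adj x y) (hx : x ∈ B) (hy : y ∈ B) : ReachIn G B x y :=
  ⟨.cons h .nil, by simp [hx, hy]⟩

theorem tail (h : ReachIn G B x y) (hyz : G.Adj y z) (hz : z ∈ B) : ReachIn G B x z :=
  h.trans (of_adj hyz h.mem_right hz)

end ReachIn

/-- A walk that may use the extra vertex `v` either avoids `v`, or can be cut at the first visit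
of `v`. -/
theorem ReachIn.of_insert {B : Set V} {v x y : V} (hx : x ∈ B)
    (h : ReachIn G (insert v B) x y) :
    ReachIn G B x y ∨ ∃ s, ReachIn G B x s ∧ G.Adj v s := by
  obtain ⟨p, hp⟩ := h
  induction p with
  | nil => exact .inl (.refl hx)
  | @cons x x' y hadj p ih =>
    by_cases hv : x' = v
    · subst hv
      exact .inr ⟨x, .refl hx, hadj.symm⟩
    · have hx' : x' ∈ B := (hp x' (by simp)).resolve_left hv
      have hxx' : ReachIn G B x x' := .of_adj hadj hx hx'
      rcases ih hx' fun u hu => hp u (by simp [hu]) with h | ⟨s, h, hs⟩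
      · exact .inl (hxx'.trans h)
      · exact .inr ⟨s, hxx'.trans h, hs⟩

theorem exists_walk_of_induce {W : Set V} {a b : W} (p : (G.induce W).Walk a b) :
    ∃ q : G.Walk (a : V) b, q.support = p.support.map Subtype.val := by
  induction p with
  | nil => exact ⟨.nil, by simp⟩
  | cons h p ih =>
    obtain ⟨q, hq⟩ := ih
    exact ⟨.cons (SimpleGraph.induce_adj.1 h) q, by
      rw [SimpleGraph.Walk.support_cons, hq, SimpleGraph.Walk.support_cons, List.map_cons]⟩

theorem reachIn_iff_reachable {B : Set V} {x y : V} (hx : x ∈ B) (hy : y ∈ B) :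
    ReachIn G B x y ↔ (G.induce B).Reachable ⟨x, hx⟩ ⟨y, hy⟩ := by
  constructor
  · rintro ⟨p, hp⟩
    exact ⟨p.induce B hp⟩
  · rintro ⟨p⟩
    obtain ⟨q, hq⟩ := exists_walk_of_induce p
    refine ⟨q, fun u hu => ?_⟩
    rw [hq, List.mem_map] at hu
    obtain ⟨w, -, rfl⟩ := hu
    exact w.2

/-! ### Sets without clique minimal separators -/

theorem exists_isMinimalUVSeparator_subset [Finite V] {u v : V} {S : Set V}
    (h : IsSeparator G u v S) : ∃ S' ⊆ S, IsMinimalUVSeparator G u v S' := by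
  obtain ⟨S', hle, hS'⟩ := exists_minimal_le_of_wellFoundedLT (IsSeparator G u v) S h
  exact ⟨S', hle, hS'.prop, fun R hR hsep => hR.not_subset (hS'.le_of_le hsep hR.subset)⟩

theorem isSeparator_induce_iff {A T : Set V} {a b : A} (ha : (a : V) ∉ T) (hb : (b : V) ∉ T) :
    IsSeparator (G.induce A) a b {x | (x : V) ∈ T} ↔ ¬ ReachIn G (A \ T) a b := by
  classical
  refine ⟨fun h => ?_, fun h => ⟨ha, hb, fun p _ => ?_⟩⟩
  · rintro ⟨p, hp⟩
    obtain ⟨x, hx, hxT⟩ := h.2.2 (p.induce A fun u hu => (hp u hu).1).bypass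
      (SimpleGraph.Walk.bypass_isPath _)
    have hx' := SimpleGraph.Walk.support_bypass_subset_support _ hx
    rw [SimpleGraph.Walk.support_induce] at hx'
    exact (hp x (by simpa using hx')).2 hxT
  · by_contra! hcon
    obtain ⟨q, hq⟩ := exists_walk_of_induce p
    refine h ⟨q, fun u hu => ?_⟩
    rw [hq, List.mem_map] at hu
    obtain ⟨w, hw, rfl⟩ := hu
    exact ⟨w.2, hcon w hw⟩

/-- A nonempty set induces a connected graph without clique minimal separator if and only if
deleting any clique leaves it connected. Minimality of the separator is immaterial, as subsets of
cliques are cliques; the empty clique accounts for connectedness. -/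
theorem isPrimeSet_iff [Finite V] {A : Set V} :
    IsPrimeSet G A ↔ A.Nonempty ∧ ∀ T : Set V, G.IsClique T →
      ∀ a ∈ A \ T, ∀ b ∈ A \ T, ReachIn G (A \ T) a b := by
  constructor
  · rintro ⟨hconn, hsep⟩
    refine ⟨Set.nonempty_coe_sort.1 hconn.nonempty, fun T hT a ha b hb => ?_⟩
    by_contra hcon
    obtain ⟨S, hS, hmin⟩ := exists_isMinimalUVSeparator_subset
      ((isSeparator_induce_iff (a := ⟨a, ha.1⟩) (b := ⟨b, hb.1⟩) ha.2 hb.2).2 hcon)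
    exact hsep ⟨S, ⟨_, _, hmin⟩, fun x hx y hy hxy =>
      hT (hS hx) (hS hy) (Subtype.coe_injective.ne hxy)⟩
  · rintro ⟨hne, h⟩
    have := hne.to_subtype
    refine ⟨⟨fun a b => ?_⟩, ?_⟩
    · refine (reachIn_iff_reachable a.2 b.2).1 ?_
      exact (h ∅ (by simp) a (by simp) b (by simp)).mono Set.sdiff_subset
    · rintro ⟨S, ⟨a, b, hS, -⟩, hcl⟩
      have hS' : S = {x : A | (x : V) ∈ Subtype.val '' S} := by ext; simp
      have hclique : G.IsClique (Subtype.val '' S) := by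
        rintro _ ⟨x, hx, rfl⟩ _ ⟨y, hy, rfl⟩ hxy
        exact hcl hx hy fun h => hxy (h ▸ rfl)
      have ha : (a : V) ∉ Subtype.val '' S := by simpa using hS.1
      have hb : (b : V) ∉ Subtype.val '' S := by simpa using hS.2.1
      rw [hS', isSeparator_induce_iff ha hb] at hS
      exact hS (h _ hclique a ⟨a.2, ha⟩ b ⟨b.2, hb⟩)

/-! ### Convexity relative to a vertex set -/

/-- `H` is a convex set of the induced subgraph `G_W`, expressed by walks of `G`: a walk in `W`
between distinct vertices of `H` that meets `H` only in its ends has adjacent ends. -/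
def RelConvex (G : SimpleGraph V) (W H : Set V) : Prop :=
  H ⊆ W ∧ ∀ u ∈ H, ∀ v ∈ H, u ≠ v → ∀ p : G.Walk u v,
    (∀ x ∈ p.support, x ∈ W ∧ (x ∈ H → x = u ∨ x = v)) → G.Adj u v

theorem isConvexSet_induce_iff {W : Set V} {A : Set W} :
    IsConvexSet (G.induce W) A ↔ RelConvex G W (Subtype.val '' A) := by
  classical
  constructor
  · refine fun h => ⟨by rintro _ ⟨x, -, rfl⟩; exact x.2, ?_⟩
    rintro _ ⟨u, hu, rfl⟩ _ ⟨v, hv, rfl⟩ huv p hp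
    by_contra hadj
    refine h u hu v hv (fun e => huv (e ▸ rfl)) hadj
      ⟨(p.induce W fun x hx => (hp x hx).1).bypass, SimpleGraph.Walk.bypass_isPath _,
        fun x hx hxu hxv hxA => ?_⟩
    have hx' := SimpleGraph.Walk.support_bypass_subset_support _ hx
    rw [SimpleGraph.Walk.support_induce] at hx'
    rcases (hp x (by simpa using hx')).2 ⟨x, hxA, rfl⟩ with h | h
    · exact hxu (Subtype.ext h)
    · exact hxv (Subtype.ext h)
  · rintro h u hu v hv huv hadj ⟨p, -, hp⟩
    obtain ⟨q, hq⟩ := exists_walk_of_induce p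
    refine hadj (h.2 u ⟨u, hu, rfl⟩ v ⟨v, hv, rfl⟩ (Subtype.coe_injective.ne huv) q fun x hx => ?_)
    rw [hq, List.mem_map] at hx
    obtain ⟨w, hw, rfl⟩ := hx
    refine ⟨w.2, ?_⟩
    rintro ⟨w', hw', e⟩
    obtain rfl : w' = w := Subtype.ext e
    by_contra! hne
    exact hp w' hw (fun e => hne.1 (e ▸ rfl)) (fun e => hne.2 (e ▸ rfl)) hw'

/-- A convex set meets a walk between two of its vertices in a walk. -/
theorem RelConvex.exists_walk {W H : Set V} (h : RelConvex G W H) {a b : V} (ha : a ∈ H)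
    (hb : b ∈ H) (p : G.Walk a b) (hp : ∀ x ∈ p.support, x ∈ W) :
    ∃ q : G.Walk a b, ∀ x ∈ q.support, x ∈ H ∧ x ∈ p.support := by
  have hH : Subtype.val '' ((↑) ⁻¹' H : Set W) = H := by
    simpa using h.1
  obtain ⟨q, hq⟩ := exists_walk_in_convexSet (G.induce W)
    (isConvexSet_induce_iff.2 (hH.symm ▸ h)) (p.induce W hp) ha hb
  obtain ⟨r, hr⟩ := exists_walk_of_induce q
  refine ⟨r, fun u hu => ?_⟩
  rw [hr, List.mem_map] at hu
  obtain ⟨w, hw, rfl⟩ := hu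
  have := hq w hw
  rw [SimpleGraph.Walk.support_induce] at this
  exact ⟨this.1, by simpa using this.2⟩

theorem RelConvex.mono {W W' A : Set V} (h : RelConvex G W (A ∩ W)) (hW : W' ⊆ W) :
    RelConvex G W' (A ∩ W') :=
  ⟨Set.inter_subset_right, fun u hu v hv huv p hp => h.2 u ⟨hu.1, hW hu.2⟩ v ⟨hv.1, hW hv.2⟩ huv p
    fun x hx => ⟨hW (hp x hx).1, fun hxA => (hp x hx).2 ⟨hxA.1, (hp x hx).1⟩⟩⟩

/-- The neighbours in a convex set of a connected set outside it form a clique. -/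
theorem RelConvex.adj_of_reachIn {W H : Set V} (h : RelConvex G W H) {s t c d : V} (hs : s ∈ H)
    (ht : t ∈ H) (hst : s ≠ t) (hsc : G.Adj s c) (hdt : G.Adj d t)
    (hcd : ReachIn G (W \ H) c d) : G.Adj s t := by
  obtain ⟨p, hp⟩ := hcd
  refine h.2 s hs t ht hst (.cons hsc (p.append (.cons hdt .nil))) fun x hx => ?_
  simp only [SimpleGraph.Walk.support_cons, List.mem_cons,
    SimpleGraph.Walk.mem_support_append_iff, SimpleGraph.Walk.support_nil, List.not_mem_nil,
    or_false] at hx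
  rcases hx with rfl | hx | rfl | rfl
  · exact ⟨h.1 hs, fun _ => .inl rfl⟩
  · exact ⟨(hp x hx).1, fun hxH => absurd hxH (hp x hx).2⟩
  · have := hp x p.end_mem_support
    exact ⟨this.1, fun hxH => absurd hxH this.2⟩
  · exact ⟨h.1 ht, fun _ => .inr rfl⟩

/-! ### One pass of the loop -/

theorem self_mem_hullStep (W : Set V) (v : W) : (v : V) ∈ hullStep G W v :=
  ⟨v, subset_hull _ _ (.inl rfl), rfl⟩

theorem mem_hullStep_of_adj {W : Set V} {v : W} {x : V} (hx : x ∈ W) (h : G.Adj v x) :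
    x ∈ hullStep G W v :=
  ⟨⟨x, hx⟩, subset_hull _ _ (.inr ⟨v, rfl, h⟩), rfl⟩

theorem relConvex_hullStep [Finite V] (W : Set V) (v : W) : RelConvex G W (hullStep G W v) :=
  isConvexSet_induce_iff.1 (isLeast_hull _ _).1.2

theorem hullStep_subset_of_relConvex [Finite V] {W A : Set V} {v : W} (hA : RelConvex G W A)
    (hv : (v : V) ∈ A) (h : ∀ x ∈ W, G.Adj v x → x ∈ A) : hullStep G W v ⊆ A := by
  have hA' : Subtype.val '' ((↑) ⁻¹' A : Set W) = A := by simpa using hA.1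
  rw [← hA']
  refine Set.image_mono ((isLeast_hull _ _).2 ⟨?_, isConvexSet_induce_iff.2 (hA'.symm ▸ hA)⟩)
  rintro x (rfl | ⟨w, rfl, hx⟩)
  · exact hv
  · exact h x x.2 hx

theorem mem_nextVertices {W H : Set V} {x : V} :
    x ∈ nextVertices G W H ↔ x ∈ W ∧ (x ∉ H ∨ ∃ w ∈ W, w ∉ H ∧ G.Adj w x) := by
  constructor
  · rintro ⟨x, hx | ⟨w, hw, hwx⟩, rfl⟩
    · exact ⟨x.2, .inl hx⟩
    · exact ⟨x.2, .inr ⟨w, w.2, hw, hwx⟩⟩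
  · rintro ⟨hxW, hx | ⟨w, hwW, hw, hwx⟩⟩
    · exact ⟨⟨x, hxW⟩, .inl hx, rfl⟩
    · exact ⟨⟨x, hxW⟩, .inr ⟨⟨w, hwW⟩, hw, hwx⟩, rfl⟩

/-- A prime subset of `W` does not cross a convex set `H`: if it contains a vertex outside `H`,
the clique of neighbours in `H` of the component of that vertex cannot separate it. -/
theorem IsPrimeSet.subset_or_subset_nextVertices [Finite V] {W H A : Set V} (hH : RelConvex G W H)
    (hA : IsPrimeSet G A) (hAW : A ⊆ W) : A ⊆ H ∨ A ⊆ nextVertices G W H := by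
  rw [or_iff_not_imp_left, Set.not_subset]
  rintro ⟨x, hxA, hxH⟩ y hyA
  set S : Set V := {s | s ∈ H ∧ ∃ c, ReachIn G (W \ H) x c ∧ G.Adj c s} with hS
  have hSclique : G.IsClique S := by
    rintro s ⟨hs, c, hc, hcs⟩ t ⟨ht, d, hd, hdt⟩ hst
    exact hH.adj_of_reachIn hs ht hst hcs.symm hdt (hc.symm.trans hd)
  rw [mem_nextVertices]
  refine ⟨hAW hyA, ?_⟩
  by_cases hyS : y ∈ S
  · obtain ⟨hyH, c, hc, hcy⟩ := hyS
    exact .inr ⟨c, hc.mem_right.1, hc.mem_right.2, hcy⟩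
  obtain ⟨p, hp⟩ := (isPrimeSet_iff.1 hA).2 S hSclique x ⟨hxA, fun h => hxH h.1⟩ y ⟨hyA, hyS⟩
  -- The walk from `x` avoids `S`, so it never leaves the component of `x` in `W \ H`.
  have key : ∀ (u : V) (q : G.Walk u y), ReachIn G (W \ H) x u →
      (∀ w ∈ q.support, w ∈ A \ S) → ReachIn G (W \ H) x y := by
    intro u q hu hq
    induction q with
    | nil => exact hu
    | @cons u u' _ h q ih =>
      have hu' := hq u' (by simp)
      exact ih hyA hyS p hp (hu.tail h ⟨hAW hu'.1, fun hH' => hu'.2 ⟨hH', u, hu, h⟩⟩)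
        fun w hw => hq w (by simp [hw])
  exact .inl (key x p (.refl ⟨hAW hxA, hxH⟩) hp).mem_right.2

/-! ### Clique separations at a vertex -/

/-- A partition of `B` into a clique `T` containing `z` and two sides `X`, `Y` without edges
between them, such that `z` has a neighbour on either side. -/
structure IsSplitting (G : SimpleGraph V) (B T X Y : Set V) (z : V) : Prop where
  clique : G.IsClique T
  mem : z ∈ T
  cover : T ∪ (X ∪ Y) = B
  disjoint_left : Disjoint T X
  disjoint_right : Disjoint T Y
  disjoint_sides : Disjoint X Y
  not_adj : ∀ x ∈ X, ∀ y ∈ Y, ¬ G.Adj x y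
  left : ∃ x ∈ X, G.Adj z x
  right : ∃ y ∈ Y, G.Adj z y

/-- `G[B]` has a splitting at `z`: the vertex `z` lies in a clique whose removal from `G[B]` puts
two neighbours of `z` into different components. -/
def SplitsAt (G : SimpleGraph V) (B : Set V) (z : V) : Prop :=
  ∃ T X Y, IsSplitting G B T X Y z

theorem IsSplitting.symm {B T X Y : Set V} {z : V} (h : IsSplitting G B T X Y z) :
    IsSplitting G B T Y X z where
  clique := h.clique
  mem := h.mem
  cover := by rw [Set.union_comm Y X, h.cover]
  disjoint_left := h.disjoint_right
  disjoint_right := h.disjoint_left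
  disjoint_sides := h.disjoint_sides.symm
  not_adj := fun x hx y hy hxy => h.not_adj y hy x hx hxy.symm
  left := h.right
  right := h.left

/-- A splitting is determined by the clique `T` and one side `X`. -/
theorem splitsAt_of_side {B T X : Set V} {z x y : V} (hT : G.IsClique T) (hTB : T ⊆ B)
    (hXB : X ⊆ B) (hTX : ∀ a ∈ X, a ∉ T) (hz : z ∈ T)
    (hX : ∀ a ∈ X, ∀ b ∈ B, b ∉ T → G.Adj a b → b ∈ X)
    (hx : x ∈ X) (hzx : G.Adj z x) (hy : y ∈ B) (hyT : y ∉ T) (hyX : y ∉ X) (hzy : G.Adj z y) :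
    SplitsAt G B z :=
  ⟨T, X, {b | b ∈ B ∧ b ∉ T ∧ b ∉ X},
    { clique := hT
      mem := hz
      cover := by
        ext b
        have h1 := @hTB b
        have h2 := @hXB b
        simp only [Set.mem_union, Set.mem_ofPred_eq]
        tauto
      disjoint_left := Set.disjoint_right.2 hTX
      disjoint_right := Set.disjoint_right.2 fun b hb => hb.2.1
      disjoint_sides := Set.disjoint_right.2 fun b hb => hb.2.2
      not_adj := fun a ha b hb hab => hb.2.2 (hX a ha b hb.1 hb.2.1 hab)
      left := ⟨x, hx, hzx⟩
      right := ⟨y, ⟨hy, hyT, hyX⟩, hzy⟩ }⟩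

/-- The convex hull of the closed neighbourhood of `v` in `G_W` is prime as soon as no clique
through `v` separates two neighbours of `v` in `G_W`. A clique `T` avoiding `v` cannot separate the
hull, since `T` and the component of `v` already form a convex set containing the neighbourhood. -/
theorem isPrimeSet_hullStep [Finite V] {W : Set V} {v : W} (hv : ¬ SplitsAt G W v) :
    IsPrimeSet G (hullStep G W v) := by
  set H := hullStep G W v with hHdef
  have hH : RelConvex G W H := relConvex_hullStep W v
  have hvH : (v : V) ∈ H := self_mem_hullStep W v
  have avoid : ∀ T : Set V, G.IsClique T → (v : V) ∉ T → ∀ a ∈ H \ T, ReachIn G (H \ T) v a := by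
    intro T hT hvT a ha
    set C : Set V := {y | ReachIn G (H \ T) v y} with hC
    set A : Set V := C ∪ (T ∩ H) with hA
    have hAH : A ⊆ H := Set.union_subset (fun y hy => hy.mem_right.1) Set.inter_subset_right
    have hstep : ∀ u ∈ C, ∀ x ∈ H, G.Adj u x → x ∈ A := by
      intro u hu x hx hux
      by_cases hxT : x ∈ T
      · exact .inr ⟨hxT, hx⟩
      · exact .inl (ReachIn.tail hu hux ⟨hx, hxT⟩)
    -- A walk that starts in the component of `v` cannot leave `A` at once.
    have hfrom : ∀ u ∈ C, ∀ w ∈ A, u ≠ w → ∀ p : G.Walk u w,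
        (∀ x ∈ p.support, x ∈ W ∧ (x ∈ A → x = u ∨ x = w)) → G.Adj u w := by
      intro u hu w hw huw p hp
      obtain ⟨q, hq⟩ := hH.exists_walk (hAH (.inl hu)) (hAH hw) p fun x hx => (hp x hx).1
      cases q with
      | nil => exact absurd rfl huw
      | @cons _ x _ hux q =>
        have hx := hq x (by simp)
        rcases (hp x hx.2).2 (hstep u hu x hx.1 hux) with rfl | rfl
        · exact absurd hux (G.irrefl)
        · exact hux
    have hconv : RelConvex G W A := by
      refine ⟨hAH.trans hH.1, fun u hu w hw huw p hp => ?_⟩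
      rcases hu with hu | hu
      · exact hfrom u hu w hw huw p hp
      rcases hw with hw | hw
      · refine (hfrom w hw u (.inr hu) huw.symm p.reverse fun x hx => ?_).symm
        have := hp x (by simpa using hx)
        exact ⟨this.1, fun h => (this.2 h).symm⟩
      · exact hT hu.1 hw.1 huw
    have hvC : (v : V) ∈ C := ReachIn.refl ⟨hvH, hvT⟩
    have := hullStep_subset_of_relConvex hconv (.inl hvC) fun x hx hvx =>
      hstep v hvC x (mem_hullStep_of_adj hx hvx) hvx
    exact (this ha.1).resolve_right fun h => ha.2 h.1
  refine isPrimeSet_iff.2 ⟨⟨v, hvH⟩, fun T hT a ha b hb => ?_⟩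
  by_cases hvT : (v : V) ∈ T
  swap
  · exact (avoid T hT hvT a ha).symm.trans (avoid T hT hvT b hb)
  by_contra hcon
  -- Without `v` the clique does not separate, so any walk from `a` to `b` runs through `v`, which
  -- then has neighbours on both sides.
  have hins : H \ (T \ {(v : V)}) ⊆ insert (v : V) (H \ T) := by
    rintro x ⟨hxH, hxT⟩
    by_cases hxv : x = v
    · exact .inl hxv
    · exact .inr ⟨hxH, fun h => hxT ⟨h, hxv⟩⟩
  have hT' : G.IsClique (T \ {(v : V)}) := hT.subset Set.sdiff_subset
  have hmem : ∀ x ∈ H \ T, x ∈ H \ (T \ {(v : V)}) := fun x hx => ⟨hx.1, fun h => hx.2 h.1⟩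
  have hab : ReachIn G (insert (v : V) (H \ T)) a b :=
    ((avoid _ hT' (by simp) a (hmem a ha)).symm.trans (avoid _ hT' (by simp) b (hmem b hb))).mono
      hins
  obtain ⟨s, has, hvs⟩ := (ReachIn.of_insert ha hab).resolve_left hcon
  obtain ⟨t, hbt, hvt⟩ := (ReachIn.of_insert hb hab.symm).resolve_left fun h => hcon h.symm
  have hHW : H \ T ⊆ W \ T := fun x hx => ⟨hH.1 hx.1, hx.2⟩
  have hat : ¬ ReachIn G (W \ T) a t := by
    rintro ⟨p, hp⟩
    obtain ⟨q, hq⟩ := hH.exists_walk ha.1 hbt.mem_right.1 p fun x hx => (hp x hx).1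
    exact hcon (ReachIn.trans ⟨q, fun x hx => ⟨(hq x hx).1, (hp x (hq x hx).2).2⟩⟩ hbt.symm)
  refine hv (splitsAt_of_side (T := T ∩ W) (X := {x | ReachIn G (W \ T) a x})
    (hT.subset Set.inter_subset_left) Set.inter_subset_right (fun x hx => hx.mem_right.1)
    (fun x hx h => hx.mem_right.2 h.1) ⟨hvT, v.2⟩ (fun x hx y hy hyT hxy => ReachIn.tail hx hxy
      ⟨hy, fun h => hyT ⟨h, hy⟩⟩) (has.mono hHW) hvs (hHW hbt.mem_right).1
      (fun h => hbt.mem_right.2 h.1) hat hvt)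

/-- A splitting of a part of `G_W` that survives a pass of the loop extends to `G_W`, provided
some vertex `c` of the closed neighbourhood of `z` lies outside `H`. Let `C` be the component of
`c` in `W \ H` and `S` the clique of its neighbours in `H`. Then either the part of one side inside
`C` can be split off by the same clique, or `S` contains `z` and splits off `C`. -/
theorem splitsAt_of_splitsAt_nextVertices {W H R : Set V} {z c : V} (hH : RelConvex G W H)
    (hc : c ∈ W ∩ R) (hcH : c ∉ H) (hzc : c = z ∨ G.Adj z c)
    (h : SplitsAt G (nextVertices G W H ∩ R) z) : SplitsAt G (W ∩ R) z := by
  obtain ⟨T, X, Y, h⟩ := h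
  set C : Set V := {y | ReachIn G (W \ H) c y} with hC
  set S : Set V := {s | s ∈ H ∧ ∃ d, ReachIn G (W \ H) c d ∧ G.Adj d s} with hS
  have hSclique : G.IsClique S := by
    rintro s ⟨hs, d, hd, hds⟩ t ⟨ht, e, he, het⟩ hst
    exact hH.adj_of_reachIn hs ht hst hds.symm het (hd.symm.trans he)
  have hcC : c ∈ C := ReachIn.refl ⟨hc.1, hcH⟩
  have hstep : ∀ u ∈ C, ∀ x ∈ W, G.Adj u x → x ∈ C ∨ x ∈ S := by
    intro u hu x hx hux
    by_cases hxH : x ∈ H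
    · exact .inr ⟨hxH, u, hu, hux⟩
    · exact .inl (ReachIn.tail hu hux ⟨hx, hxH⟩)
  have hCS : ∀ u ∈ C, u ∉ S := fun u hu hS' => hu.mem_right.2 hS'.1
  have hCnext : ∀ u ∈ C, u ∈ nextVertices G W H := fun u hu =>
    mem_nextVertices.2 ⟨hu.mem_right.1, .inl hu.mem_right.2⟩
  have hSnext : ∀ u ∈ S, u ∈ nextVertices G W H := fun u ⟨huH, d, hd, hdu⟩ =>
    mem_nextVertices.2 ⟨hH.1 huH, .inr ⟨d, hd.mem_right.1, hd.mem_right.2, hdu⟩⟩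
  have hnextW : nextVertices G W H ∩ R ⊆ W ∩ R := fun u hu => ⟨(mem_nextVertices.1 hu.1).1, hu.2⟩
  -- One of the two sides is disjoint from the clique `S`.
  have hside : ∃ X Y, IsSplitting G (nextVertices G W H ∩ R) T X Y z ∧ ∀ y ∈ Y, y ∉ S := by
    by_cases hY : ∀ y ∈ Y, y ∉ S
    · exact ⟨X, Y, h, hY⟩
    · push Not at hY
      obtain ⟨y, hy, hyS⟩ := hY
      exact ⟨Y, X, h.symm, fun x hx hxS => h.not_adj x hx y hy
        (hSclique hxS hyS fun e => Set.disjoint_left.1 h.disjoint_sides hx (e ▸ hy))⟩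
  clear h X Y
  obtain ⟨X, Y, h, hYS⟩ := hside
  obtain ⟨x, hx, hzx⟩ := h.left
  obtain ⟨y, hy, hzy⟩ := h.right
  have hTsub : T ⊆ nextVertices G W H ∩ R := h.cover ▸ Set.subset_union_left
  have hXsub : X ⊆ nextVertices G W H ∩ R :=
    h.cover ▸ Set.subset_union_left.trans Set.subset_union_right
  have hYsub : Y ⊆ nextVertices G W H ∩ R :=
    h.cover ▸ Set.subset_union_right.trans Set.subset_union_right
  by_cases hyC : y ∈ C
  · refine splitsAt_of_side (T := T) (X := Y ∩ C) (x := y) (y := x) h.clique (hTsub.trans hnextW)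
      (fun a ha => hnextW (hYsub ha.1)) (fun a ha => Set.disjoint_right.1 h.disjoint_right ha.1)
      h.mem (fun a ha b hb hbT hab => ?_) ⟨hy, hyC⟩ hzy (hnextW (hXsub hx))
      (Set.disjoint_right.1 h.disjoint_left hx)
      (fun hxY => Set.disjoint_left.1 h.disjoint_sides hx hxY.1) hzx
    have hbCS := hstep a ha.2 b hb.1 hab
    have hbnext : b ∈ T ∪ (X ∪ Y) := by
      rw [h.cover]
      exact ⟨hbCS.elim (hCnext b) (hSnext b), hb.2⟩
    have hbY : b ∈ Y := (hbnext.resolve_left hbT).resolve_left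
      fun hbX => h.not_adj b hbX a ha.1 hab.symm
    exact ⟨hbY, hbCS.resolve_right (hYS b hbY)⟩
  · have hyW := hnextW (hYsub hy)
    have hzC : z ∉ C := fun hzC => (hstep z hzC y hyW.1 hzy).elim hyC (hYS y hy)
    have hzc' : G.Adj z c := hzc.resolve_left fun e => hzC (e ▸ hcC)
    have hzW := hnextW (hTsub h.mem)
    have hzS : z ∈ S := (hstep c hcC z hzW.1 hzc'.symm).resolve_left hzC
    exact splitsAt_of_side (T := S ∩ R) (X := C ∩ R) (hSclique.subset Set.inter_subset_left)
      (fun a ha => ⟨hH.1 ha.1.1, ha.2⟩) (fun a ha => ⟨ha.1.mem_right.1, ha.2⟩)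
      (fun a ha haS => hCS a ha.1 haS.1) ⟨hzS, hzW.2⟩
      (fun a ha b hb hbS hab => ⟨(hstep a ha.1 b hb.1 hab).resolve_right fun h => hbS ⟨h, hb.2⟩,
        hb.2⟩) ⟨hcC, hc.2⟩ hzc' hyW (fun hyS => hYS y hy hyS.1) (fun h => hyC h.1) hzy

/-! ### Maximum Cardinality Search -/

open Classical in
theorem MCSRun.weight_eq_countP {L : List V} {w : V → ℕ} (h : MCSRun G L w) :
    ∀ u ∉ L, w u = L.countP fun x => G.Adj x u := by
  induction h with
  | init => simp
  | @step L w _ v hv _ ih =>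
    intro u hu
    rw [List.countP_cons, ← ih u fun h => hu (List.mem_cons_of_mem _ h)]
    by_cases hadj : G.Adj v u <;> simp_all

theorem MCSRun.of_append {L' L : List V} {w : V → ℕ} (h : MCSRun G (L' ++ L) w) :
    ∃ w', MCSRun G L w' := by
  induction L' generalizing w with
  | nil => exact ⟨w, h⟩
  | cons v L' ih =>
    cases h with
    | step h => exact ih h

open Classical in
/-- Seen from the numbered vertices `L`, no excess has built up on the side `Y` of a clique `T`
through `z`: no numbered vertex of `Y` is a neighbour of `z`, and no unnumbered vertex of `Y` has
more numbered neighbours than there are numbered vertices in `T`. -/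
def NoExcess (G : SimpleGraph V) (T Y : Set V) (z : V) (L : List V) : Prop :=
  ∀ y ∈ Y, (y ∈ L → ¬ G.Adj z y) ∧
    (y ∉ L → L.countP (fun x => G.Adj x y) ≤ L.countP (fun x => x ∈ T))

theorem imp_of_countP_le {L : List V} {p q : V → Bool} (hpq : ∀ a ∈ L, p a → q a)
    (h : L.countP q ≤ L.countP p) : ∀ a ∈ L, q a → p a := by
  induction L with
  | nil => simp
  | cons b L ih =>
    have hpq' : ∀ a ∈ L, p a → q a := fun a ha => hpq a (List.mem_cons_of_mem _ ha)
    have hle := List.countP_mono_left hpq'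
    have hb := hpq b List.mem_cons_self
    rw [List.countP_cons, List.countP_cons] at h
    intro a ha hqa
    rcases List.mem_cons.1 ha with rfl | ha
    · by_contra hpa
      simp only [hqa, hpa, if_true] at h
      simp at h
      omega
    · refine ih hpq' ?_ a ha hqa
      cases hpb : p b
      · simp only [hpb] at h
        simp at h
        omega
      · simp only [hpb, hb hpb] at h
        simpa using h

/-- If the side `Y` has no excess before a step of the search, then some side has none after it.
Only choosing a vertex of `Y` can spoil `Y`; but such a choice shows that no weight exceeds the
number of numbered vertices of `T`, so that `X` has no excess either. -/
theorem NoExcess.step {B T X Y : Set V} {z v : V} {L : List V} {w : V → ℕ}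
    (h : IsSplitting G B T X Y z) (hrun : MCSRun G L w) (hv : v ∉ L) (hvB : v ∈ B)
    (hmax : ∀ u, u ∉ L → w u ≤ w v) (hzL : z ∉ L) (hY : NoExcess G T Y z L) :
    NoExcess G T X z (v :: L) ∨ NoExcess G T Y z (v :: L) := by
  classical
  have hdisj : ∀ {A : Set V}, Disjoint T A → ∀ a ∈ A, a ∉ T := fun hA a ha =>
    Set.disjoint_right.1 hA ha
  rw [← h.cover] at hvB
  rcases hvB with hvT | hvX | hvY
  · refine .inr fun y hy => ⟨fun hyL => (hY y hy).1 ((List.mem_cons.1 hyL).resolve_left ?_),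
      fun hyL => ?_⟩
    · rintro rfl
      exact hdisj h.disjoint_right y hy hvT
    · have := (hY y hy).2 fun h => hyL (List.mem_cons_of_mem _ h)
      rw [List.countP_cons, List.countP_cons]
      simp only [hvT, decide_true, if_true]
      split_ifs <;> omega
  · refine .inr fun y hy => ⟨fun hyL => (hY y hy).1 ((List.mem_cons.1 hyL).resolve_left ?_),
      fun hyL => ?_⟩
    · rintro rfl
      exact Set.disjoint_left.1 h.disjoint_sides hvX hy
    · have := (hY y hy).2 fun h => hyL (List.mem_cons_of_mem _ h)
      rw [List.countP_cons, List.countP_cons]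
      simpa [h.not_adj v hvX y hy, hdisj h.disjoint_left v hvX] using this
  · have hle : ∀ u ∉ L, L.countP (fun x => G.Adj x u) ≤ L.countP (fun x => x ∈ T) := by
      intro u hu
      rw [← hrun.weight_eq_countP u hu]
      refine (hmax u hu).trans ?_
      rw [hrun.weight_eq_countP v hv]
      exact (hY v hvY).2 hv
    refine .inl fun x hx => ⟨fun hxL hzx => ?_, fun hxL => ?_⟩
    · have hxv : x ≠ v := by
        rintro rfl
        exact Set.disjoint_left.1 h.disjoint_sides hx hvY
      have := imp_of_countP_le (p := fun x => decide (x ∈ T)) (q := fun x => decide (G.Adj x z))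
        (fun a ha haT => by
          simp only [decide_eq_true_eq] at haT ⊢
          exact h.clique haT h.mem fun e => hzL (e ▸ ha)) (hle z hzL) x
        ((List.mem_cons.1 hxL).resolve_left hxv) (by simpa using hzx.symm)
      exact hdisj h.disjoint_left x hx (by simpa using this)
    · have := hle x fun h => hxL (List.mem_cons_of_mem _ h)
      rw [List.countP_cons, List.countP_cons]
      have hvx : ¬ G.Adj v x := fun e => h.not_adj x hx v hvY e.symm
      simpa [hvx, hdisj h.disjoint_right v hvY] using this

theorem MCSRun.noExcess {B T X Y : Set V} {z : V} {L : List V} {w : V → ℕ}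
    (h : IsSplitting G B T X Y z) (hrun : MCSRun G L w) (hzL : z ∉ L) (hLB : ∀ u ∈ L, u ∈ B) :
    NoExcess G T X z L ∨ NoExcess G T Y z L := by
  induction hrun with
  | init => exact .inl fun y _ => by simp
  | @step L w hrun v hv hmax ih =>
    have hzL' : z ∉ L := fun h => hzL (List.mem_cons_of_mem _ h)
    have hvB := hLB v List.mem_cons_self
    rcases ih hzL' fun u hu => hLB u (List.mem_cons_of_mem _ hu) with hX | hY
    · exact (hX.step h.symm hrun hv hvB hmax hzL').symm
    · exact hY.step h hrun hv hvB hmax hzL'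

/-- At the time Maximum Cardinality Search numbers `z`, no clique through `z` separates two
neighbours of `z` within the vertices numbered so far. -/
theorem IsMCSOrdering.not_splitsAt [Fintype V] {α : V ≃ Fin (Fintype.card V)}
    (hα : IsMCSOrdering G α) (z : V) : ¬ SplitsAt G {u | α z ≤ α u} z := by
  rintro ⟨T, X, Y, h⟩
  obtain ⟨w, hw⟩ := hα
  set L := (List.ofFn α.symm).drop (α z + 1) with hL
  have hlt : (α z : ℕ) < (List.ofFn α.symm).length := by simp
  have hcons : (List.ofFn α.symm).drop (α z) = z :: L := by
    rw [List.drop_eq_getElem_cons hlt]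
    simp [hL]
  have hmem : ∀ u, u ∈ z :: L ↔ α z ≤ α u := by
    intro u
    rw [← hcons, List.mem_drop_iff_getElem]
    constructor
    · rintro ⟨i, hi, rfl⟩
      simp [Fin.le_def]
    · intro hu
      refine ⟨α u - α z, ?_, ?_⟩
      · have := (α u).2
        simp
        omega
      · have : (α z : ℕ) + (α u - α z) = α u := by
          have : (α z : ℕ) ≤ α u := hu
          omega
        simp [this]
  rw [← List.take_append_drop (α z) (List.ofFn α.symm), hcons] at hw
  obtain ⟨w', hw'⟩ := hw.of_append
  cases hw' with
  | step hrun _ hzL _ =>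
    have hside : ∀ y, y ∈ {u | α z ≤ α u} → G.Adj z y → y ∈ L := fun y hy hzy =>
      (List.mem_cons.1 ((hmem y).2 hy)).resolve_left hzy.ne'
    obtain ⟨x, hx, hzx⟩ := h.left
    obtain ⟨y, hy, hzy⟩ := h.right
    rcases hrun.noExcess h hzL fun u hu => (hmem u).1 (List.mem_cons_of_mem _ hu) with hX | hY
    · exact (hX x hx).1 (hside x (h.cover ▸ .inr (.inl hx)) hzx) hzx
    · exact (hY y hy).1 (hside y (h.cover ▸ .inr (.inr hy)) hzy) hzy

/-! ### The loop -/

/-- The loop invariant, for the current vertex set `W` and the family `U` found so far. -/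
structure LoopInvariant [Fintype V] (G : SimpleGraph V) (α : V ≃ Fin (Fintype.card V))
    (W : Set V) (U : Set (Set V)) : Prop where
  prime : ∀ A ∈ U, IsPrimeSet G A
  atom : ∀ A, IsGraphAtom G A → A ∈ U ∨ A ⊆ W
  antichain : ∀ A ∈ U, ∀ B ∈ U, A ⊆ B → A = B
  not_subset : ∀ A ∈ U, ¬ A ⊆ W
  convex : ∀ A ∈ U, RelConvex G W (A ∩ W)
  /-- What is left of the effect of the search: `z` does not split the part of `W` with labels at
  least that of `z`, unless some member of `U` contains the closed neighbourhood of `z` there. -/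
  not_splitsAt : ∀ z ∈ W,
    (∀ A ∈ U, ∃ c ∈ W ∩ {u | α z ≤ α u}, (c = z ∨ G.Adj z c) ∧ c ∉ A) →
      ¬ SplitsAt G (W ∩ {u | α z ≤ α u}) z

variable [Fintype V] {α : V ≃ Fin (Fintype.card V)}

theorem LoopInvariant.init (hα : IsMCSOrdering G α) : LoopInvariant G α Set.univ ∅ where
  prime := by simp
  atom := by simp
  antichain := by simp
  not_subset := by simp
  convex := by simp
  not_splitsAt := fun z _ _ => by
    rw [Set.univ_inter]
    exact hα.not_splitsAt z

/-- The hull of a pass is prime or contained in a member of `U` found before. The second case does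
occur with a hull that is not prime: the ordering restricted to `W` need not be an ordering that
Maximum Cardinality Search produces on `G_W`. -/
theorem LoopInvariant.isPrimeSet_or_subset {W : Set V} {U : Set (Set V)}
    (h : LoopInvariant G α W U) {v : W} (hv : ∀ u ∈ W, α v ≤ α u) :
    IsPrimeSet G (hullStep G W v) ∨ ∃ A ∈ U, hullStep G W v ⊆ A := by
  have hW : W ∩ {u | α v ≤ α u} = W := Set.inter_eq_left.2 hv
  by_cases hcase : ∀ A ∈ U, ∃ c ∈ W, (c = v ∨ G.Adj v c) ∧ c ∉ A
  · left
    have := h.not_splitsAt v v.2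
    rw [hW] at this
    exact isPrimeSet_hullStep (this hcase)
  · right
    push Not at hcase
    obtain ⟨A, hA, hN⟩ := hcase
    refine ⟨A, hA, (hullStep_subset_of_relConvex (h.convex A hA)
      ⟨hN v v.2 (.inl rfl), v.2⟩ fun x hx hvx => ⟨hN x hx (.inr hvx), hx⟩).trans
      Set.inter_subset_left⟩

open Classical in
theorem LoopInvariant.step {W : Set V} {U : Set (Set V)} (h : LoopInvariant G α W U) {v : W}
    (hv : ∀ u ∈ W, α v ≤ α u) :
    LoopInvariant G α (nextVertices G W (hullStep G W v))
      (if ∀ A ∈ U, ¬ hullStep G W v ⊆ A then insert (hullStep G W v) U else U) := by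
  set H := hullStep G W v with hHdef
  set W' := nextVertices G W H with hW'
  set U' := if ∀ A ∈ U, ¬ H ⊆ A then insert H U else U with hU'
  have hconv : RelConvex G W H := relConvex_hullStep W v
  have hW'W : W' ⊆ W := (nextVertices_ssubset G W v).subset
  have hUU' : U ⊆ U' := by
    rw [hU']
    split_ifs
    exacts [Set.subset_insert _ _, subset_rfl]
  have hmem : ∀ A ∈ U', A ∈ U ∨ (A = H ∧ ∀ A ∈ U, ¬ H ⊆ A) := by
    intro A hA
    rw [hU'] at hA
    split_ifs at hA with hif
    · exact hA.symm.imp_right fun e => ⟨e, hif⟩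
    · exact .inl hA
  have hcov : ∃ A ∈ U', H ⊆ A := by
    rw [hU']
    split_ifs with hif
    · exact ⟨H, Set.mem_insert _ _, subset_rfl⟩
    · simpa using hif
  have hHW : ¬ H ⊆ W' := fun hsub => by
    obtain ⟨-, hvH | ⟨w, hw, hwH, hwv⟩⟩ := mem_nextVertices.1 (hsub (self_mem_hullStep W v))
    · exact hvH (self_mem_hullStep W v)
    · exact hwH (mem_hullStep_of_adj hw hwv.symm)
  have hprime : ∀ A ∈ U', IsPrimeSet G A := by
    intro A hA
    rcases hmem A hA with hA | ⟨rfl, hnone⟩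
    · exact h.prime A hA
    · exact (h.isPrimeSet_or_subset hv).resolve_right fun ⟨A, hA, hsub⟩ => hnone A hA hsub
  refine ⟨hprime, fun A hA => ?_, fun A hA B hB hAB => ?_, fun A hA => ?_, fun A hA => ?_,
    fun z hz hall hsplit => ?_⟩
  · rcases h.atom A hA with hAU | hAW
    · exact .inl (hUU' hAU)
    · refine (hA.prop.subset_or_subset_nextVertices hconv hAW).imp_left fun hAH => ?_
      obtain ⟨B, hB, hHB⟩ := hcov
      rwa [hA.eq_of_le (hprime B hB) (hAH.trans hHB)]
  · rcases hmem A hA with hAU | ⟨rfl, hnone⟩ <;> rcases hmem B hB with hBU | ⟨rfl, -⟩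
    · exact h.antichain A hAU B hBU hAB
    · exact absurd (hAB.trans hconv.1) (h.not_subset A hAU)
    · exact absurd hAB (hnone B hBU)
    · rfl
  · rcases hmem A hA with hAU | ⟨rfl, -⟩
    · exact fun hsub => h.not_subset A hAU (hsub.trans hW'W)
    · exact hHW
  · rcases hmem A hA with hAU | ⟨rfl, -⟩
    · exact (h.convex A hAU).mono hW'W
    · refine RelConvex.mono (W := W) ?_ hW'W
      rwa [Set.inter_eq_left.2 hconv.1]
  · have hsub : W' ∩ {u | α z ≤ α u} ⊆ W ∩ {u | α z ≤ α u} :=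
      Set.inter_subset_inter_left _ hW'W
    obtain ⟨B, hB, hHB⟩ := hcov
    obtain ⟨c, hc, hzc, hcB⟩ := hall B hB
    refine h.not_splitsAt z (hW'W hz) (fun A hA => ?_) (splitsAt_of_splitsAt_nextVertices hconv
      (hsub hc) (fun hcH => hcB (hHB hcH)) hzc hsplit)
    obtain ⟨d, hd, hzd, hdA⟩ := hall A (hUU' hA)
    exact ⟨d, hsub hd, hzd, hdA⟩

theorem LoopInvariant.after_rdaLoop {W : Set V} {U : Set (Set V)} (h : LoopInvariant G α W U) :
    LoopInvariant G α ∅ (rdaLoop G α W U) := by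
  induction hn : W.ncard using Nat.strong_induction_on generalizing W U with
  | _ n ih =>
    rw [rdaLoop]
    split_ifs with hW
    · refine ih _ ?_ (h.step fun u hu => ?_) rfl
      · rw [← hn]
        exact Set.ncard_lt_ncard (nextVertices_ssubset G W _)
      · exact Function.argminOn_le α W hu
    · rwa [← Set.not_nonempty_iff_eq_empty.1 hW]

theorem LoopInvariant.eq_setOf_isGraphAtom {U : Set (Set V)} (h : LoopInvariant G α ∅ U) :
    U = {A | IsGraphAtom G A} := by
  have hatom : ∀ A, IsGraphAtom G A → A ∈ U := fun A hA => (h.atom A hA).resolve_right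
    fun hsub => (isPrimeSet_iff.1 hA.prop).1.ne_empty (Set.subset_empty_iff.1 hsub)
  refine Set.Subset.antisymm (fun A hA => ?_) hatom
  obtain ⟨B, hAB, hB⟩ := Finite.exists_le_maximal (h.prime A hA)
  rwa [Set.mem_ofPred_eq, h.antichain A hA B (hatom B hB) hAB]

end RDA

theorem mainTheorem2 {V : Type*} [Fintype V] (G : SimpleGraph V)
    (α : V ≃ Fin (Fintype.card V)) (hα : RDA.IsMCSOrdering G α) :
    RDA.rda G α = {A : Set V | RDA.IsGraphAtom G A} :=
  (RDA.LoopInvariant.init hα).after_rdaLoop.eq_setOf_isGraphAtom
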